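/- Let $P$ be a finite poset with $n$ elements, labeled by $[n]=\{1,\dots,n\}$, and assume that $P$ is a rooted forest, i.e. every element is covered by at most one element. Let $\mathcal L(P)$ be the set of linear extensions of $P$, written as words $\pi=\pi_1\cdots\pi_n$ (so $i\prec j$ in $P$ implies that $i$ stands to the left of $j$ in $\pi$). For $\pi\in\mathcal L(P)$ and $1\le j\le n$ let $\pi\partial_j\in\mathcal L(P)$ be the extended promotion of $\pi$: place at each $i\in P$ the label $\pi^{-1}_i$; remove the label $j$; repeatedly move into the vacated element the smallest label among the elements covering it, until the vacated element is maximal; place the label $n+1$ there; finally decrease all labels larger than $j$ by $1$. The promotion graph has vertex set $\mathcal L(P)$ and, for each $\pi$ and $j$, an edge $\pi\to\pi\partial_j$ of weight $x_{\pi_j}$. Its transition matrix $M$ has as $(\pi',\pi)$ entry, for $\pi'\ne\pi$, the sum of the weights of the edges $\pi\to\pi'$, and as $(\pi,\pi)$ entry minus the sum of the weights of the edges leaving $\pi$, not counting loops. Here $x_1,\dots,x_n$ are indeterminates, or arbitrary elements of a commutative ring. Put $\overline M=M+(x_1+\cdots+x_n)\mathbb 1$. Let $L$ be the lattice of upper sets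 of $P$, ordered by inclusion, with largest element $\hat 1=P$. For $S\in L$ let $x_S=\sum_{i\in S}x_i$ and $$d_S=\sum_{T\in L,\ T\supseteq S}\mu(S,T)\,f([T,\hat 1]),$$ where $\mu$ is the Möbius function of $L$ and $f([T,\hat 1])$ is the number of maximal chains in the interval $[T,\hat 1]$ of $L$. Theorem. Every $d_S$ is a nonnegative integer, and $$\det(\overline M-\lambda\mathbb 1)=\prod_{S\in L}(x_S-\lambda)^{d_S}.$$ In other words, the eigenvalues of $\overline M$, that is, the roots of its characteristic polynomial counted with multiplicity (over an integral domain), are the $x_S$, $S\in L$, each taken $d_S$ times. -/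

import Mathlib

/-- A rooted forest: a disjoint union of rooted trees, i.e. a poset in which each element has at
most one successor (is covered by at most one element). -/
def IsRootedForest (P : Type*) [PartialOrder P] : Prop :=
  ∀ p q r : P, p ⋖ q → p ⋖ r → q = r

/-- Linear extensions `π = π₀ π₁ ⋯ π_{n-1}` (positions are counted from `0`) of a finite poset
`P` with `n` elements: bijections from positions to elements such that `p ≺ q` implies that `p`
stands to the left of `q`. -/
@[ext]
structure LinearExt (P : Type*) [Fintype P] [PartialOrder P] where
  /-- The word `π`: `π.word k` is the entry in position `k`. -/
  word : Fin (Fintype.card P) ≃ P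
  symm_lt_symm : ∀ p q : P, p < q → word.symm p < word.symm q

namespace LinearExt

variable {P : Type*} [Fintype P] [PartialOrder P]

noncomputable instance : DecidableEq (LinearExt P) := Classical.decEq _

noncomputable instance : Fintype (LinearExt P) :=
  haveI : Finite (LinearExt P) :=
    Finite.of_injective LinearExt.word fun _ _ h => LinearExt.ext h
  Fintype.ofFinite _

/-- The label of the element `p`, that is, its position in `π`. -/
def label (π : LinearExt P) (p : P) : ℕ := (π.word.symm p : ℕ)

end LinearExt

section Promotion

variable {P : Type*} [Fintype P] [PartialOrder P]

open Classical in
/-- The sliding process of promotion, for a labelling `ℓ` with labels `0, …, n - 1`, when the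
label at `p` has just been removed. If `p` is not maximal, the smallest label among the elements
covering `p`, say the one at `q`, is moved to `p`, and the process continues at `q`. If `p` is
maximal, the process ends by placing the new label `n` at `p`. -/
noncomputable def slide (ℓ : P → ℕ) (p : P) : P → ℕ :=
  if h : {q | p ⋖ q}.Nonempty then
    slide (Function.update ℓ p (ℓ (Function.argminOn ℓ {q | p ⋖ q} h)))
      (Function.argminOn ℓ {q | p ⋖ q} h)
  else Function.update ℓ p (Fintype.card P)
termination_by (Finset.univ.filter (p < ·)).card
decreasing_by
  have hq : p < Function.argminOn ℓ {q | p ⋖ q} h :=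
    CovBy.lt (Function.argminOn_mem ℓ {q | p ⋖ q} h)
  refine Finset.card_lt_card ⟨fun r hr => ?_, fun h' => ?_⟩
  · simp only [Finset.mem_filter, Finset.mem_univ, true_and] at hr ⊢
    exact hq.trans hr
  · have h2 := h' (by simpa using hq)
    simp at h2

/-- Decrease by `1` every label larger than `j`. -/
def lower (j v : ℕ) : ℕ := if j < v then v - 1 else v

/-- The labelling produced by extended promotion with seed the label `j`: slide, starting at the
element labelled `j`, and then decrease by `1` all labels strictly larger than `j`. -/
noncomputable def promotedLabel (π : LinearExt P) (j : Fin (Fintype.card P)) (p : P) : ℕ :=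
  lower j (slide π.label (π.word j) p)

theorem slide_of_not_le (ℓ : P → ℕ) (p r : P) (h : ¬ p ≤ r) : slide ℓ p r = ℓ r := by
  classical
  induction ℓ, p using slide.induct with
  | case1 ℓ p hc ih =>
    have hq : p < Function.argminOn ℓ {q | p ⋖ q} hc :=
      CovBy.lt (Function.argminOn_mem ℓ {q | p ⋖ q} hc)
    rw [slide, dif_pos hc, ih (fun h' => h (hq.le.trans h')), Function.update_of_ne]
    rintro rfl
    exact h le_rfl
  | case2 ℓ p hc =>
    rw [slide, dif_neg hc, Function.update_of_ne]
    rintro rfl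
    exact h le_rfl

theorem slide_value (ℓ : P → ℕ) (p r : P) (h : p ≤ r) :
    slide ℓ p r = Fintype.card P ∨ ∃ s, p < s ∧ slide ℓ p r = ℓ s := by
  classical
  induction ℓ, p using slide.induct with
  | case1 ℓ p hc ih =>
    have hq : p < Function.argminOn ℓ {q | p ⋖ q} hc :=
      CovBy.lt (Function.argminOn_mem ℓ {q | p ⋖ q} hc)
    rw [slide, dif_pos hc]
    by_cases hr : Function.argminOn ℓ {q | p ⋖ q} hc ≤ r
    · rcases ih hr with h1 | ⟨s, hs, h1⟩
      · exact Or.inl h1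
      · refine Or.inr ⟨s, hq.trans hs, ?_⟩
        rw [h1, Function.update_of_ne]
        exact (hq.trans hs).ne'
    · rw [slide_of_not_le _ _ _ hr]
      right
      by_cases hrp : r = p
      · subst hrp
        exact ⟨_, hq, by simp⟩
      · exact ⟨r, lt_of_le_of_ne h (Ne.symm hrp), by rw [Function.update_of_ne hrp]⟩
  | case2 ℓ p hc =>
    rw [slide, dif_neg hc]
    by_cases hrp : r = p
    · subst hrp
      simp
    · exact Or.inr ⟨r, lt_of_le_of_ne h (Ne.symm hrp), by rw [Function.update_of_ne hrp]⟩

open Classical in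
theorem slide_of_min (ℓ : P → ℕ) (p q : P) (hpq : p ⋖ q)
    (hmin : ∀ r, p ⋖ r → r ≠ q → ℓ q < ℓ r) :
    slide ℓ p = slide (Function.update ℓ p (ℓ q)) q := by
  have hc : {q | p ⋖ q}.Nonempty := ⟨q, hpq⟩
  have h : Function.argminOn ℓ {q | p ⋖ q} hc = q := by
    by_contra hne
    exact Function.not_lt_argminOn ℓ {q | p ⋖ q} hpq
      (hmin _ (Function.argminOn_mem ℓ {q | p ⋖ q} hc) hne)
  rw [slide, dif_pos hc, h]

theorem slide_congr (ℓ ℓ' : P → ℕ) (p r : P) (hinj : Set.InjOn ℓ (Set.Ioi p))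
    (h : ∀ s, p < s → ℓ s = ℓ' s) (hr : p ≤ r) : slide ℓ p r = slide ℓ' p r := by
  classical
  induction ℓ, p using slide.induct generalizing ℓ' with
  | case1 ℓ p hc ih =>
    obtain ⟨q, hq⟩ : ∃ q, q = Function.argminOn ℓ {q | p ⋖ q} hc := ⟨_, rfl⟩
    have hpq : p ⋖ q := hq ▸ Function.argminOn_mem ℓ {q | p ⋖ q} hc
    have hmin : ∀ s, p ⋖ s → s ≠ q → ℓ q < ℓ s := by
      intro s hs hsq
      refine lt_of_le_of_ne ?_ (fun h' => hsq (hinj hs.lt hpq.lt h'.symm))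
      rw [hq]
      exact Function.argminOn_le ℓ {q | p ⋖ q} hs
    rw [slide_of_min ℓ p q hpq hmin, slide_of_min ℓ' p q hpq (fun s hs hsq => by
      rw [← h s hs.lt, ← h q hpq.lt]; exact hmin s hs hsq)]
    by_cases hqr : q ≤ r
    · rw [← hq] at ih
      refine ih _ ?_ ?_ hqr
      · intro a ha b hb hab
        have ha' := hpq.lt.trans ha
        have hb' := hpq.lt.trans hb
        rw [Function.update_of_ne ha'.ne', Function.update_of_ne hb'.ne'] at hab
        exact hinj ha' hb' hab
      · intro s hs
        have hs' := hpq.lt.trans hs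
        rw [Function.update_of_ne hs'.ne', Function.update_of_ne hs'.ne', h s hs']
    · rw [slide_of_not_le _ _ _ hqr, slide_of_not_le _ _ _ hqr]
      by_cases hrp : r = p
      · subst hrp
        simp [h q hpq.lt]
      · rw [Function.update_of_ne hrp, Function.update_of_ne hrp,
          h r (lt_of_le_of_ne hr (Ne.symm hrp))]
  | case2 ℓ p hc =>
    rw [slide, dif_neg hc, slide, dif_neg hc]
    by_cases hrp : r = p
    · subst hrp
      simp
    · rw [Function.update_of_ne hrp, Function.update_of_ne hrp,
          h r (lt_of_le_of_ne hr (Ne.symm hrp))]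

theorem swap_isLinearExt (π : LinearExt P) (i : ℕ) (hi : i + 1 < Fintype.card P)
    (hc : ¬ (π.word ⟨i, by omega⟩ ≤ π.word ⟨i + 1, hi⟩ ∨ π.word ⟨i + 1, hi⟩ ≤ π.word ⟨i, by omega⟩))
    (p q : P) (hpq : p < q) :
    ((Equiv.swap ⟨i, by omega⟩ ⟨i + 1, hi⟩).trans π.word).symm p <
      ((Equiv.swap ⟨i, by omega⟩ ⟨i + 1, hi⟩).trans π.word).symm q := by
  have h := π.symm_lt_symm p q hpq
  have hbad : ¬ (π.word.symm p = ⟨i, by omega⟩ ∧ π.word.symm q = ⟨i + 1, hi⟩) := by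
    rintro ⟨h1, h2⟩
    rw [Equiv.symm_apply_eq] at h1 h2
    exact hc (Or.inl (h1 ▸ h2 ▸ hpq.le))
  simp only [Equiv.symm_trans_apply, Equiv.symm_swap]
  generalize π.word.symm p = a at *
  generalize π.word.symm q = b at *
  simp only [Equiv.swap_apply_def, Fin.ext_iff, Fin.lt_def] at *
  split_ifs <;> simp <;> omega

open Classical in
/-- The operator `τ_i`: interchange the entries in positions `i` and `i + 1` if they are not
comparable in `P`. -/
noncomputable def tau (π : LinearExt P) (i : ℕ) : LinearExt P :=
  if hi : i + 1 < Fintype.card P then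
    if hc : π.word ⟨i, by omega⟩ ≤ π.word ⟨i + 1, hi⟩ ∨ π.word ⟨i + 1, hi⟩ ≤ π.word ⟨i, by omega⟩ then π
    else ⟨(Equiv.swap ⟨i, by omega⟩ ⟨i + 1, hi⟩).trans π.word, swap_isLinearExt π i hi hc⟩
  else π

/-- The product `π τ_j τ_{j+1} ⋯ τ_{n-2}` (positions counted from `0`). -/
noncomputable def tauProd (π : LinearExt P) (j : ℕ) : LinearExt P :=
  (List.range' j (Fintype.card P - 1 - j)).foldl tau π

theorem label_tauProd (π : LinearExt P) (j : Fin (Fintype.card P)) (r : P) :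
    (tauProd π j).label r = promotedLabel π j r := by
  classical
  obtain ⟨m, hm⟩ : ∃ m, m = Fintype.card P - 1 - (j : ℕ) := ⟨_, rfl⟩
  have hinj : ∀ (π : LinearExt P) (a b : P), π.label a = π.label b → a = b := by
    intro π a b hab
    exact π.word.symm.injective (Fin.ext hab)
  have hlt : ∀ (π : LinearExt P) (a b : P), a < b → π.label a < π.label b := by
    intro π a b hab
    exact π.symm_lt_symm a b hab
  have hbd : ∀ (π : LinearExt P) (a : P), π.label a < Fintype.card P := by
    intro π a
    exact (π.word.symm a).2
  have hlab : ∀ (π : LinearExt P) (k : Fin (Fintype.card P)), π.label (π.word k) = k := by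
    intro π k
    simp [LinearExt.label]
  induction m generalizing π j with
  | zero =>
    have hj : (j : ℕ) + 1 = Fintype.card P := by have := j.2; omega
    have hmax : ∀ s, ¬ π.word j < s := by
      intro s hs
      have h1 := hlt π _ _ hs
      have h2 := hbd π s
      rw [hlab] at h1
      omega
    have hc : ¬ {q | π.word j ⋖ q}.Nonempty := fun ⟨q, hq⟩ => hmax q hq.lt
    rw [tauProd, ← hm, promotedLabel, slide, dif_neg hc]
    simp only [List.range'_zero, List.foldl_nil]
    by_cases hr : r = π.word j
    · subst hr
      rw [hlab, Function.update_self, lower]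
      split_ifs <;> omega
    · have h2 := hbd π r
      rw [Function.update_of_ne hr, lower, if_neg (by omega)]
  | succ m ih =>
    obtain ⟨k, hk⟩ := j
    simp only at hm
    have hk1 : k + 1 < Fintype.card P := by omega
    have hrec : tauProd π k = tauProd (tau π k) (k + 1) := by
      rw [tauProd, tauProd, ← hm, List.range'_succ, List.foldl_cons]
      congr 2
      omega
    have ih' := ih (tau π k) ⟨k + 1, hk1⟩ (by simp only; omega)
    simp only at ih'
    rw [hrec, ih']
    unfold promotedLabel
    simp only
    obtain ⟨p, hp⟩ : ∃ p, p = π.word ⟨k, hk⟩ := ⟨_, rfl⟩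
    obtain ⟨q, hq⟩ : ∃ q, q = π.word ⟨k + 1, hk1⟩ := ⟨_, rfl⟩
    have hlp : π.label p = k := by rw [hp, hlab]
    have hlq : π.label q = k + 1 := by rw [hq, hlab]
    have hnq : ∀ s, s ≠ q → π.label s ≠ k + 1 := by
      intro s hs h
      exact hs (hinj π _ _ (h.trans hlq.symm))
    have hnp : ∀ s, s ≠ p → π.label s ≠ k := by
      intro s hs h
      exact hs (hinj π _ _ (h.trans hlp.symm))
    have hlow : ∀ v, v ≠ k + 1 → lower (k + 1) v = lower k v := by
      intro v hv
      unfold lower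
      split_ifs <;> omega
    rw [← hp]
    by_cases hc : p ≤ q ∨ q ≤ p
    · have hpq : p < q := by
        rcases hc with h | h
        · exact lt_of_le_of_ne h (by rintro rfl; omega)
        · have := hlt π q p (lt_of_le_of_ne h (by rintro rfl; omega))
          omega
      have htau : tau π k = π := by
        unfold tau
        rw [dif_pos hk1, dif_pos (by rw [← hp, ← hq]; exact hc)]
      rw [htau, ← hq]
      have hcov : p ⋖ q := by
        refine ⟨hpq, fun s h1 h2 => ?_⟩
        have h3 := hlt π _ _ h1
        have h4 := hlt π _ _ h2
        omega
      rw [slide_of_min π.label p q hcov (fun s hs hsq => by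
        have h3 := hlt π _ _ hs.lt
        have h4 := hnq s hsq
        omega)]
      by_cases hr : q ≤ r
      · rw [← slide_congr π.label (Function.update π.label p (π.label q)) q r
          (fun a _ b _ hab => hinj π a b hab)
          (fun s hs => by rw [Function.update_of_ne (hpq.trans hs).ne']) hr]
        apply hlow
        rcases slide_value π.label q r hr with h | ⟨s, hs, h⟩
        · omega
        · have := hlt π _ _ hs
          omega
      · rw [slide_of_not_le _ _ _ hr, slide_of_not_le _ _ _ hr]
        by_cases hrp : r = p
        · subst hrp
          rw [Function.update_self, hlp, hlq]
          simp [lower]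
        · rw [Function.update_of_ne hrp]
          exact hlow _ (hnq r (fun h => hr h.ge))
    · have hpq : p ≠ q := by
        rintro rfl
        exact hc (Or.inl le_rfl)
      have htau : tau π k = ⟨(Equiv.swap ⟨k, hk⟩ ⟨k + 1, hk1⟩).trans π.word,
          swap_isLinearExt π k hk1 (by rw [← hp, ← hq]; exact hc)⟩ := by
        unfold tau
        rw [dif_pos hk1, dif_neg (by rw [← hp, ← hq]; exact hc)]
      have hp' : (tau π k).word ⟨k + 1, hk1⟩ = p := by
        rw [htau]
        simp [hp]
      have hlp' : (tau π k).label p = k + 1 := by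
        rw [← hp', hlab]
      have hlq' : (tau π k).label q = k := by
        have : (tau π k).word ⟨k, hk⟩ = q := by
          rw [htau]
          simp [hq]
        rw [← this, hlab]
      have hl' : ∀ s, s ≠ p → s ≠ q → π.label s = (tau π k).label s := by
        intro s h1 h2
        have h3 := hnp s h1
        have h4 := hnq s h2
        rw [htau]
        unfold LinearExt.label at *
        simp only [Equiv.symm_trans_apply, Equiv.symm_swap]
        rw [Equiv.swap_apply_of_ne_of_ne]
        · exact fun h => h3 (by rw [h])
        · exact fun h => h4 (by rw [h])
      rw [hp']
      by_cases hr : p ≤ r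
      · rw [← slide_congr π.label (tau π k).label p r (fun a _ b _ hab => hinj π a b hab)
          (fun s hs => hl' s hs.ne' (by rintro rfl; exact hc (Or.inl hs.le))) hr]
        apply hlow
        rcases slide_value π.label p r hr with h | ⟨s, hs, h⟩
        · omega
        · rw [h]
          exact hnq s (by rintro rfl; exact hc (Or.inl hs.le))
      · rw [slide_of_not_le _ _ _ hr, slide_of_not_le _ _ _ hr]
        by_cases hrq : r = q
        · subst hrq
          rw [hlq, hlq']
          simp [lower]
        · rw [← hl' r (fun h => hr h.ge) hrq]
          exact hlow _ (hnq r hrq)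

theorem exists_promoted (π : LinearExt P) (j : Fin (Fintype.card P)) :
    ∃ σ : LinearExt P, ∀ p, σ.label p = promotedLabel π j p :=
  ⟨tauProd π j, label_tauProd π j⟩

/-- Extended promotion `π ∂_j`: the linear extension whose labels are those produced from the
labels of `π` by the sliding process with seed `j`. -/
noncomputable def promote (π : LinearExt P) (j : Fin (Fintype.card P)) : LinearExt P :=
  Classical.choose (exists_promoted π j)

theorem label_promote (π : LinearExt P) (j : Fin (Fintype.card P)) (p : P) :
    (promote π j).label p = promotedLabel π j p :=
  Classical.choose_spec (exists_promoted π j) p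

theorem promote_eq_tauProd (π : LinearExt P) (j : Fin (Fintype.card P)) :
    promote π j = tauProd π j := by
  apply LinearExt.ext
  apply Equiv.symm_bijective.injective
  ext p
  exact (label_promote π j p).trans (label_tauProd π j p).symm

/-- The transition matrix of the promotion graph. For each `π` and each position `j` the graph
has an edge `π → π ∂_j` of weight `x_{π_j}`. The `(π', π)` entry is the sum of the weights of
the edges `π → π'` if `π' ≠ π`; the `(π, π)` entry is minus the sum of the weights of the edges
leaving `π`, loops not counted. -/
noncomputable def promotionMatrix {R : Type*} [CommRing R] (x : P → R) :
    Matrix (LinearExt P) (LinearExt P) R :=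
  Matrix.of fun π' π =>
    if π' = π then -∑ j with promote π j ≠ π, x (π.word j)
    else ∑ j with promote π j = π', x (π.word j)

/-- The matrix `M + (∑ x_i) 1`. -/
noncomputable def shiftedPromotionMatrix {R : Type*} [CommRing R] (x : P → R) :
    Matrix (LinearExt P) (LinearExt P) R :=
  promotionMatrix x + (∑ i, x i) • (1 : Matrix (LinearExt P) (LinearExt P) R)

end Promotion

/-- The upper sets of a finite poset, ordered by inclusion. (Mathlib's `UpperSet P` carries the
opposite order.) -/
@[ext]
structure UpperSetLattice (P : Type*) [PartialOrder P] where
  /-- The underlying set of elements. -/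
  carrier : Finset P
  isUpperSet : IsUpperSet (carrier : Set P)

namespace UpperSetLattice

variable {P : Type*} [PartialOrder P]

instance : PartialOrder (UpperSetLattice P) :=
  PartialOrder.lift carrier fun _ _ h => UpperSetLattice.ext h

instance [Fintype P] : OrderTop (UpperSetLattice P) where
  top := ⟨Finset.univ, by simpa using isUpperSet_univ⟩
  le_top S := Finset.subset_univ S.carrier

noncomputable instance : DecidableEq (UpperSetLattice P) := Classical.decEq _

noncomputable instance [Fintype P] : Fintype (UpperSetLattice P) :=
  haveI : Finite (UpperSetLattice P) :=
    Finite.of_injective carrier fun _ _ h => UpperSetLattice.ext h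
  Fintype.ofFinite _

open Classical in
noncomputable instance [Fintype P] : LocallyFiniteOrder (UpperSetLattice P) :=
  Fintype.toLocallyFiniteOrder

end UpperSetLattice

/-- The number of maximal chains in the interval `[y, 1̂]`. -/
noncomputable def numMaxChains {L : Type*} [PartialOrder L] [OrderTop L] (y : L) : ℕ :=
  {c : Set (Set.Icc y (⊤ : L)) | IsMaxChain (· ≤ ·) c}.ncard

/-- The derangement number `d_x = ∑_{y ≥ x} μ(x, y) f([y, 1̂])`. -/
noncomputable def derangementNumber {L : Type*} [PartialOrder L] [OrderTop L]
    [LocallyFiniteOrder L] [DecidableEq L] (x : L) : ℤ :=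
  ∑ y ∈ Finset.Icc x ⊤, IncidenceAlgebra.mu ℤ x y * (numMaxChains y : ℤ)

/-! The shifted matrix is `∑ x_i F_i`, where `F_i` is the matrix of the map `promoteAt · i`. Its
`k`-th power is a sum over words `w` of length `k`, and the trace of a term is its monomial times
the number of linear extensions fixed by the word. Let `T` be the upper set generated by the letters
of `w`. The heart of the proof is that this number is `f([T, 1̂])`, which depends on `T` only
(`card_promoteWord_eq_self`). Möbius inversion writes it as the sum of `d_S` over `S ⊇ T`, and
summing over words gives `tr M̄^k = ∑ d_S x_S^k` for every `k`. For indeterminates the `x_S` are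
distinct, so in characteristic zero the power sums determine the multiplicities; they must be the
`d_S`, which are therefore nonnegative. Any other ring is reached by specialization.

The fixed points are found by a coalescence argument. In a forest, sliding involves no choice, and
two extensions that agree from position `m` on still do so after any promotion; a seed left of `m`
even makes them agree from `m - 1` on (`agreeFrom_promoteAt_of_lt`). Choosing `m` minimal shows that
two fixed points of `w` agree on `T`, and also that a fixed point exists. In a fixed point `T` is a
final segment, and every extension with that final segment is fixed. The remaining freedom is to
order the complement of `T`, that is, to choose a maximal chain from `T` to `1̂`. -/

/-! ### Eigenvalue multiplicities from traces of powers -/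

open Polynomial in
-- Determinants are multiplicative and `p` splits, so only the linear factors `X - a` matter; for
-- these the determinant is the characteristic polynomial at `a`, up to sign.
theorem Matrix.det_aeval_eq_prod_roots_charpoly {m K : Type*} [Fintype m] [DecidableEq m]
    [Field K] [IsAlgClosed K] (A : Matrix m m K) (p : K[X]) :
    (aeval A p).det = (A.charpoly.roots.map fun e => p.eval e).prod := by
  have hchar : ∀ a : K, (A - algebraMap K (Matrix m m K) a).det =
      (A.charpoly.roots.map fun e => e - a).prod := by
    intro a
    have hs : A.charpoly = (A.charpoly.roots.map fun e => X - C e).prod :=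
      (IsAlgClosed.splits _).eq_prod_roots_of_monic A.charpoly_monic
    have hcard : Multiset.card A.charpoly.roots = Fintype.card m := by
      rw [← A.charpoly_natDegree_eq_dim]
      exact (splits_iff_card_roots.1 (IsAlgClosed.splits _))
    have h1 : (algebraMap K (Matrix m m K) a - A).det =
        (A.charpoly.roots.map fun e => a - e).prod := by
      have h2 := congrArg (eval a) hs
      rw [eval_multiset_prod, Multiset.map_map, Matrix.eval_charpoly] at h2
      simpa [Function.comp_def, Matrix.algebraMap_eq_diagonal, Matrix.scalar_apply, Pi.algebraMap_def] using h2
    rw [← neg_sub, Matrix.det_neg, h1, ← hcard]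
    have h3 : (fun e => e - a) = fun e => (-1) * (a - e) := by
      funext e
      ring
    rw [h3, Multiset.prod_map_mul, Multiset.map_const', Multiset.prod_replicate]
  have hp : p = C p.leadingCoeff * (p.roots.map fun a => X - C a).prod :=
    (IsAlgClosed.splits p).eq_prod_roots
  have hcard : Multiset.card A.charpoly.roots = Fintype.card m := by
    rw [← A.charpoly_natDegree_eq_dim]
    exact (splits_iff_card_roots.1 (IsAlgClosed.splits _))
  have key : ∀ s : Multiset K, (aeval A (s.map fun a => X - C a).prod).det =
      (A.charpoly.roots.map fun e => ((s.map fun a => X - C a).prod).eval e).prod := by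
    intro s
    induction s using Multiset.induction_on with
    | empty => simp
    | cons a s ih =>
      rw [Multiset.map_cons, Multiset.prod_cons, map_mul, Matrix.det_mul, ih]
      simp only [eval_mul, Multiset.prod_map_mul, map_sub, aeval_X, aeval_C, hchar, eval_sub,
        eval_X, eval_C]
  rw [hp, map_mul, Matrix.det_mul, key]
  simp only [eval_mul, Multiset.prod_map_mul, aeval_C, eval_C, Multiset.map_const',
    Multiset.prod_replicate, hcard, Matrix.algebraMap_eq_diagonal, Matrix.det_diagonal]
  simp

open Polynomial in
-- Applied to the polynomials `a - X ^ k`, the previous lemma evaluates the characteristic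
-- polynomial of `A ^ k` at every `a`, so its roots are the `k`-th powers of those of `A`.
theorem Matrix.trace_pow_eq_sum_roots_charpoly {m K : Type*} [Fintype m] [DecidableEq m]
    [Field K] [IsAlgClosed K] (A : Matrix m m K) (k : ℕ) :
    (A ^ k).trace = (A.charpoly.roots.map fun e => e ^ k).sum := by
  have h : (A ^ k).charpoly = ((A.charpoly.roots.map fun e => e ^ k).map fun e => X - C e).prod := by
    have : Infinite K := IsAlgClosed.instInfinite
    apply Polynomial.funext
    intro a
    have h1 := A.det_aeval_eq_prod_roots_charpoly (C a - X ^ k)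
    rw [Matrix.eval_charpoly, eval_multiset_prod, Multiset.map_map, Multiset.map_map]
    simpa [Function.comp_def, Matrix.algebraMap_eq_diagonal, Matrix.scalar_apply, Pi.algebraMap_def] using h1
  rw [Matrix.trace_eq_sum_roots_charpoly, h, roots_multiset_prod_X_sub_C]

open Polynomial in
/-- If the power sums of the eigenvalues of `A` are integer combinations of the powers of the
distinct scalars `a s`, then the coefficients are the algebraic multiplicities. -/
theorem Matrix.count_roots_charpoly_of_trace_pow {m K σ : Type*} [Fintype m] [DecidableEq m]
    [Field K] [IsAlgClosed K] [CharZero K] [Fintype σ] (A : Matrix m m K) (a : σ → K)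
    (ha : Function.Injective a) (d : σ → ℤ)
    (h : ∀ k : ℕ, (A ^ k).trace = ∑ s, (d s : K) * a s ^ k) :
    (∀ s, 0 ≤ d s) ∧ A.charpoly = ∏ s, (X - C (a s)) ^ (d s).toNat := by
  classical
  set E := A.charpoly.roots with hE
  have hpoly : ∀ p : K[X], (E.map fun e => p.eval e).sum = ∑ s, (d s : K) * p.eval (a s) := by
    intro p
    induction p using Polynomial.induction_on' with
    | add p q hp hq =>
      simp only [eval_add, Multiset.sum_map_add, hp, hq, mul_add, Finset.sum_add_distrib]
    | monomial k c =>
      simp only [eval_monomial, Multiset.sum_map_mul_left]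
      rw [hE, ← A.trace_pow_eq_sum_roots_charpoly, h, Finset.mul_sum]
      exact Finset.sum_congr rfl fun s _ => by ring
  -- Evaluating `hpoly` at a polynomial that vanishes at every eigenvalue and every `a s` other than
  -- `v` isolates the multiplicity of `v`.
  have hcount : ∀ v : K, (E.count v : K) = ∑ s, if a s = v then (d s : K) else 0 := by
    intro v
    set U := ((E.toFinset ∪ Finset.univ.image a).erase v) with hU
    set p : K[X] := ∏ u ∈ U, (X - C u) with hp
    have hpv : p.eval v ≠ 0 := by
      rw [hp, eval_prod, Finset.prod_ne_zero_iff]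
      intro u hu
      have := Finset.ne_of_mem_erase hu
      simpa [sub_eq_zero] using this.symm
    have hp0 : ∀ u, (u ∈ E ∨ u ∈ Set.range a) → u ≠ v → p.eval u = 0 := by
      intro u hu huv
      rw [hp, eval_prod]
      apply Finset.prod_eq_zero (i := u)
      · rw [hU]
        simpa [huv] using hu
      · simp
    have h1 : (E.map fun e => p.eval e).sum = E.count v * p.eval v := by
      have : E.map (fun e => p.eval e) = E.map (fun e => if e = v then p.eval v else 0) := by
        apply Multiset.map_congr rfl
        intro e he
        split_ifs with hev
        · rw [hev]
        · exact hp0 e (Or.inl he) hev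
      rw [this, Finset.sum_multiset_map_count]
      simp only [nsmul_eq_mul, mul_ite, mul_zero, Finset.sum_ite_eq']
      split_ifs with hv
      · rfl
      · rw [Multiset.count_eq_zero_of_notMem (by simpa using hv)]
        simp
    have h2 : ∑ s, (d s : K) * p.eval (a s) = (∑ s, if a s = v then (d s : K) else 0) * p.eval v := by
      rw [Finset.sum_mul]
      refine Finset.sum_congr rfl fun s _ => ?_
      split_ifs with hs
      · rw [hs]
      · rw [hp0 _ (Or.inr ⟨s, rfl⟩) hs, mul_zero, zero_mul]
    exact mul_right_cancel₀ hpv (by rw [← h1, hpoly, h2])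
  have hd : ∀ s, d s = E.count (a s) := by
    intro s
    have h1 := hcount (a s)
    simp only [ha.eq_iff, Finset.sum_ite_eq', Finset.mem_univ, if_true] at h1
    exact_mod_cast h1.symm
  refine ⟨fun s => by rw [hd]; positivity, ?_⟩
  have hEsum : E = ∑ s, (d s).toNat • ({a s} : Multiset K) := by
    ext v
    rw [Multiset.count_sum']
    -- Characteristic zero turns this identity in `K` into one between integers.
    have h1 : ((E.count v : ℤ) : K) = ((∑ s, if a s = v then d s else 0 : ℤ) : K) := by
      push_cast
      exact hcount v
    have h2 := Int.cast_injective h1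
    zify
    rw [h2]
    refine Finset.sum_congr rfl fun s _ => ?_
    rw [Multiset.count_nsmul, Multiset.count_singleton]
    split_ifs with h3 h4 h4
    · simp [hd]
    · exact absurd h3.symm h4
    · exact absurd h4.symm h3
    · simp
  have hs : A.charpoly = (E.map fun e => X - C e).prod :=
    (IsAlgClosed.splits _).eq_prod_roots_of_monic A.charpoly_monic
  rw [hs, hEsum, ← Multiset.coe_mapAddMonoidHom, map_sum, Multiset.prod_sum]
  refine Finset.prod_congr rfl fun s _ => ?_
  rw [map_nsmul, Multiset.prod_nsmul]
  simp

/-! ### Maximal chains and Möbius inversion -/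

section MaxChains

variable {L : Type*} [PartialOrder L] [OrderTop L]

/-- The maximal chains of the interval `[y, ⊤]`, as sets of elements of `L`. -/
def maxChainsFrom (y : L) : Set (Set L) :=
  {c | IsChain (· ≤ ·) c ∧ (∀ s ∈ c, y ≤ s) ∧
    ∀ s, y ≤ s → (∀ r ∈ c, r ≤ s ∨ s ≤ r) → s ∈ c}

theorem numMaxChains_eq_ncard (y : L) : numMaxChains y = (maxChainsFrom y).ncard := by
  unfold numMaxChains
  refine Set.ncard_congr (fun c _ => Subtype.val '' c) ?_ ?_ ?_
  · rintro c ⟨hc, hmax⟩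
    refine ⟨?_, ?_, ?_⟩
    · rintro _ ⟨s, hs, rfl⟩ _ ⟨r, hr, rfl⟩ hne
      exact hc hs hr (fun h => hne (by rw [h]))
    · rintro _ ⟨s, -, rfl⟩
      exact s.2.1
    · intro s hs h
      have hins : IsChain (· ≤ ·) (insert (⟨s, hs, le_top⟩ : Set.Icc y (⊤ : L)) c) := by
        refine hc.insert fun r hr _ => ?_
        exact (h r ⟨r, hr, rfl⟩).symm
      have := hmax hins (Set.subset_insert _ _)
      refine ⟨⟨s, hs, le_top⟩, ?_, rfl⟩
      rw [this]
      exact Set.mem_insert _ _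
  · intro c c' _ _ h
    exact Subtype.val_injective.image_injective h
  · rintro c ⟨hc, hy, hmax⟩
    have hval : Subtype.val '' (Subtype.val ⁻¹' c : Set (Set.Icc y (⊤ : L))) = c := by
      rw [Subtype.image_preimage_val, Set.inter_eq_right]
      exact fun s hs => ⟨hy s hs, le_top⟩
    refine ⟨Subtype.val ⁻¹' c, ⟨?_, ?_⟩, hval⟩
    · intro s hs r hr hne
      exact hc hs hr (fun h => hne (Subtype.ext h))
    · intro t ht hct
      refine hct.antisymm fun s hs => hmax s s.2.1 fun r hr => ?_
      exact ht.total (hct (show (⟨r, hy r hr, le_top⟩ : Set.Icc y (⊤ : L)) ∈ Subtype.val ⁻¹' c from hr)) hs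

theorem numMaxChains_top : numMaxChains (⊤ : L) = 1 := by
  rw [numMaxChains_eq_ncard, Set.ncard_eq_one]
  refine ⟨{⊤}, Set.ext fun c => ⟨?_, ?_⟩⟩
  · rintro ⟨-, hy, hmax⟩
    refine Set.ext fun s => ⟨fun hs => top_le_iff.1 (hy s hs), ?_⟩
    rintro rfl
    exact hmax ⊤ le_rfl fun r _ => Or.inl le_top
  · rintro rfl
    exact ⟨IsChain.singleton, fun s hs => hs.ge, fun s hs _ => top_le_iff.1 hs⟩

variable [Fintype L]

open Classical in
-- Removing `y` from a maximal chain of `[y, ⊤]` leaves a maximal chain of `[z, ⊤]`, where `z` is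
-- the next element of the chain and covers `y`.
theorem numMaxChains_eq_sum_covBy (y : L) (hy : y ≠ ⊤) :
    numMaxChains y = ∑ z with y ⋖ z, numMaxChains z := by
  have hunion : maxChainsFrom y =
      ⋃ z ∈ Finset.univ.filter (y ⋖ ·), insert y '' maxChainsFrom z := by
    ext c
    simp only [Finset.mem_filter, Finset.mem_univ, true_and, Set.mem_iUnion, exists_prop]
    constructor
    · rintro ⟨hc, hyc, hmax⟩
      have hymem : y ∈ c := hmax y le_rfl fun r hr => Or.inr (hyc r hr)
      have htop : ⊤ ∈ c := hmax ⊤ le_top fun r _ => Or.inl le_top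
      obtain ⟨z, ⟨hzc, hzy⟩, hz⟩ := (Set.toFinite (c \ {y})).exists_minimal ⟨⊤, htop, hy.symm⟩
      have hzmin : ∀ r ∈ c, r ≠ y → z ≤ r := by
        intro r hr hry
        rcases hc.total hzc hr with h | h
        · exact h
        · exact hz ⟨hr, hry⟩ h
      have hyz : y < z := lt_of_le_of_ne (hyc z hzc) (Ne.symm hzy)
      refine ⟨z, ⟨hyz, fun s hs hsz => ?_⟩, c \ {y}, ⟨hc.mono Set.sdiff_subset, ?_, ?_⟩, ?_⟩
      · have hsc : s ∈ c := by
          refine hmax s hs.le fun r hr => ?_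
          by_cases hry : r = y
          · exact Or.inl (hry ▸ hs.le)
          · exact Or.inr (hsz.le.trans (hzmin r hr hry))
        exact (hzmin s hsc hs.ne').not_gt hsz
      · exact fun s hs => hzmin s hs.1 hs.2
      · intro s hs h
        refine ⟨hmax s (hyz.le.trans hs) fun r hr => ?_, (hyz.trans_le hs).ne'⟩
        by_cases hry : r = y
        · exact Or.inl (hry ▸ hyz.le.trans hs)
        · exact h r ⟨hr, hry⟩
      · rw [Set.insert_sdiff_singleton, Set.insert_eq_of_mem hymem]
    · rintro ⟨z, hz, c, ⟨hc, hzc, hmax⟩, rfl⟩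
      refine ⟨hc.insert fun r hr _ => Or.inl (hz.le.trans (hzc r hr)), ?_, ?_⟩
      · rintro s (rfl | hs)
        · exact le_rfl
        · exact hz.le.trans (hzc s hs)
      · intro s hs h
        by_cases hzs : z ≤ s
        · exact Or.inr (hmax s hzs fun r hr => h r (Or.inr hr))
        · have hzmem : z ∈ c := hmax z le_rfl fun r hr => Or.inr (hzc r hr)
          have hsz : s < z := by
            rcases h z (Or.inr hzmem) with h1 | h1
            · exact absurd h1 hzs
            · exact lt_of_le_of_ne h1 (fun h2 => hzs h2.ge)
          left
          by_contra hne
          exact hz.2 (lt_of_le_of_ne hs (Ne.symm hne)) hsz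
  have hnotmem : ∀ z, y ⋖ z → ∀ c ∈ maxChainsFrom z, y ∉ c :=
    fun z hz c hc hyc => hz.lt.not_ge (hc.2.1 y hyc)
  have hfin : maxChainsFrom y = ((Finset.univ.filter (y ⋖ ·)).biUnion fun z =>
      (insert y '' maxChainsFrom z).toFinset : Finset (Set L)) := by
    rw [hunion]
    simp
  rw [numMaxChains_eq_ncard, hfin, Set.ncard_coe_finset, Finset.card_biUnion]
  · refine Finset.sum_congr rfl fun z hz => ?_
    rw [numMaxChains_eq_ncard, ← Set.ncard_eq_toFinset_card']
    refine Set.InjOn.ncard_image fun c hc c' hc' h => ?_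
    have hz' : y ⋖ z := by simpa using hz
    have h1 := congrArg (fun s : Set L => s \ {y}) h
    simpa [Set.insert_sdiff_of_mem, Set.sdiff_singleton_eq_self (hnotmem z hz' c hc),
      Set.sdiff_singleton_eq_self (hnotmem z hz' c' hc')] using h1
  · intro z hz z' hz' hne
    simp only [Function.onFun]
    rw [Set.disjoint_toFinset, Set.disjoint_left]
    rintro _ ⟨c, hc, rfl⟩ ⟨c', hc', h⟩
    have hz1 : y ⋖ z := by simpa using hz
    have hz2 : y ⋖ z' := by simpa using hz'
    have h1 := congrArg (fun s : Set L => s \ {y}) h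
    have h2 : c' = c := by
      simpa [Set.insert_sdiff_of_mem, Set.sdiff_singleton_eq_self (hnotmem z hz1 c hc),
        Set.sdiff_singleton_eq_self (hnotmem z' hz2 c' hc')] using h1
    subst h2
    -- Both `z` and `z'` are the least element of the common chain.
    have h3 : z ∈ c' := hc.2.2 z le_rfl fun r hr => Or.inr (hc.2.1 r hr)
    have h4 : z' ∈ c' := hc'.2.2 z' le_rfl fun r hr => Or.inr (hc'.2.1 r hr)
    exact hne (le_antisymm (hc.2.1 z' h4) (hc'.2.1 z h3))

end MaxChains

/-- After exchanging the sums, the inner sum of `μ(x, z)` over `x ∈ [y, z]` vanishes unless `z = y`.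
-/
theorem sum_Ici_derangementNumber {L : Type*} [PartialOrder L] [OrderTop L]
    [LocallyFiniteOrder L] [DecidableEq L] (y : L) :
    ∑ x ∈ Finset.Icc y ⊤, derangementNumber x = numMaxChains y := by
  unfold derangementNumber
  rw [Finset.sum_comm' (t' := Finset.Icc y ⊤) (s' := fun z => Finset.Icc y z)]
  · simp_rw [← Finset.sum_mul, IncidenceAlgebra.sum_Icc_mu_left]
    simp
  · intro x z
    simp only [Finset.mem_Icc, le_top, and_true]
    exact ⟨fun h => ⟨h, h.1.trans h.2⟩, fun h => h.1⟩

/-! ### Linear extensions through their labels -/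

section PromotionWords

variable {P : Type*} [Fintype P] [PartialOrder P]

namespace LinearExt

theorem label_injective (π : LinearExt P) : Function.Injective π.label :=
  fun _ _ h => π.word.symm.injective (Fin.ext h)

theorem label_lt_label (π : LinearExt P) {p q : P} (h : p < q) : π.label p < π.label q :=
  π.symm_lt_symm p q h

theorem label_le_label (π : LinearExt P) {p q : P} (h : p ≤ q) : π.label p ≤ π.label q := by
  rcases h.eq_or_lt with rfl | h
  · exact le_rfl
  · exact (π.label_lt_label h).le

theorem label_lt_card (π : LinearExt P) (p : P) : π.label p < Fintype.card P :=
  (π.word.symm p).2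

theorem exists_label_eq (π : LinearExt P) {k : ℕ} (hk : k < Fintype.card P) :
    ∃ p, π.label p = k :=
  ⟨π.word ⟨k, hk⟩, by simp [label]⟩

theorem ext_label {π π' : LinearExt P} (h : ∀ p, π.label p = π'.label p) : π = π' := by
  apply LinearExt.ext
  apply Equiv.symm_bijective.injective
  ext p
  exact h p

/-- Since the labels fill an initial segment of `ℕ`, the relative order of the elements determines
them. -/
theorem label_eq_card (π : LinearExt P) (p : P) :
    π.label p = (Finset.univ.filter fun q => π.label q < π.label p).card := by
  have h : (Finset.univ.filter fun q => π.label q < π.label p).image π.label =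
      Finset.range (π.label p) := by
    ext k
    simp only [Finset.mem_image, Finset.mem_filter, Finset.mem_univ, true_and, Finset.mem_range]
    constructor
    · rintro ⟨q, hq, rfl⟩
      exact hq
    · intro hk
      obtain ⟨q, rfl⟩ := π.exists_label_eq (hk.trans (π.label_lt_card p))
      exact ⟨q, hk, rfl⟩
  rw [← Finset.card_image_of_injective _ π.label_injective, h, Finset.card_range]

theorem label_eq_label_of_forall_lt_iff {π π' : LinearExt P} {p : P}
    (h : ∀ q, π.label q < π.label p ↔ π'.label q < π'.label p) : π.label p = π'.label p := by
  rw [label_eq_card, label_eq_card π']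
  simp_rw [h]

/-- Every injective and strictly increasing labelling by a linear order has the same relative
order as some linear extension. -/
theorem exists_of_strictMono {α : Type*} [LinearOrder α] (g : P → α) (hg : Function.Injective g)
    (hmono : StrictMono g) :
    ∃ π : LinearExt P, ∀ p q, π.label p < π.label q ↔ g p < g q := by
  classical
  let e : P ≃ Finset.univ.image g :=
    Equiv.ofBijective (fun p => ⟨g p, Finset.mem_image_of_mem g (Finset.mem_univ p)⟩) ⟨
      fun p q h => hg (congrArg Subtype.val h), by
        rintro ⟨a, ha⟩
        obtain ⟨p, -, rfl⟩ := Finset.mem_image.1 ha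
        exact ⟨p, rfl⟩⟩
  have hcard : (Finset.univ.image g).card = Fintype.card P := by
    rw [Finset.card_image_of_injective _ hg, Finset.card_univ]
  let o : Fin (Fintype.card P) ≃o Finset.univ.image g := (Finset.univ.image g).orderIsoOfFin hcard
  have hlt : ∀ p q, (o.toEquiv.trans e.symm).symm p < (o.toEquiv.trans e.symm).symm q ↔
      g p < g q := by
    intro p q
    simp only [Equiv.symm_trans_apply, Equiv.symm_symm]
    exact o.symm.lt_iff_lt
  exact ⟨⟨o.toEquiv.trans e.symm, fun p q h => (hlt p q).2 (hmono h)⟩, hlt⟩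

/-- The elements of `T` form a final segment of the word. -/
def EndsWith (π : LinearExt P) (T : UpperSetLattice P) : Prop :=
  ∀ t ∈ T.carrier, ∀ q ∉ T.carrier, π.label q < π.label t

/-- `π` and `π'` have the same entries in the positions from `m` on. -/
def AgreeFrom (m : ℕ) (π π' : LinearExt P) : Prop :=
  ∀ p, m ≤ π.label p ∨ m ≤ π'.label p → π.label p = π'.label p

end LinearExt

/-! ### Promotion in a rooted forest and coalescence -/

open LinearExt

/-- Extended promotion whose seed is the label of the element `i`. -/
noncomputable def promoteAt (π : LinearExt P) (i : P) : LinearExt P :=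
  promote π (π.word.symm i)

theorem IsRootedForest.le_of_covBy_of_lt (hP : IsRootedForest P) {p q r : P} (hq : p ⋖ q)
    (hr : p < r) : q ≤ r := by
  obtain ⟨s, hs, hsr⟩ := exists_covBy_le_of_lt hr
  exact hP p q s hq hs ▸ hsr

/-- The elements above `p` form a chain, so the slide runs through all of them and each receives the
label of its unique cover. -/
theorem slide_eq_of_covBy (hP : IsRootedForest P) (ℓ : P → ℕ) {p r s : P} (hpr : p ≤ r)
    (hrs : r ⋖ s) : slide ℓ p r = ℓ s := by
  classical
  induction ℓ, p using slide.induct with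
  | case1 ℓ p hc ih =>
    have hpq := Function.argminOn_mem ℓ {q | p ⋖ q} hc
    rw [slide, dif_pos hc]
    by_cases hqr : Function.argminOn ℓ {q | p ⋖ q} hc ≤ r
    · rw [ih hqr, Function.update_of_ne (hpr.trans_lt hrs.lt).ne']
    · obtain rfl : r = p := by
        by_contra hne
        exact hqr (hP.le_of_covBy_of_lt hpq (lt_of_le_of_ne hpr (Ne.symm hne)))
      rw [slide_of_not_le _ _ _ hqr, Function.update_self, hP _ _ _ hpq hrs]
  | case2 ℓ p hc =>
    exfalso
    obtain ⟨q, hq, -⟩ := exists_covBy_le_of_lt (hpr.trans_lt hrs.lt)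
    exact hc ⟨q, hq⟩

theorem slide_eq_card (hP : IsRootedForest P) (ℓ : P → ℕ) {p r : P} (hpr : p ≤ r)
    (hr : IsMax r) : slide ℓ p r = Fintype.card P := by
  classical
  induction ℓ, p using slide.induct with
  | case1 ℓ p hc ih =>
    have hpq : p ⋖ _ := Function.argminOn_mem ℓ {q | p ⋖ q} hc
    rw [slide, dif_pos hc]
    refine ih (hP.le_of_covBy_of_lt hpq (lt_of_le_of_ne hpr ?_))
    rintro rfl
    exact hr.not_lt hpq.lt
  | case2 ℓ p hc =>
    obtain rfl : r = p := by
      by_contra hne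
      obtain ⟨q, hq, -⟩ := exists_covBy_le_of_lt (lt_of_le_of_ne hpr (Ne.symm hne))
      exact hc ⟨q, hq⟩
    rw [slide, dif_neg hc, Function.update_self]

theorem label_promoteAt_of_not_le (π : LinearExt P) {i r : P} (h : ¬ i ≤ r) :
    (promoteAt π i).label r = lower (π.label i) (π.label r) := by
  rw [promoteAt, label_promote, promotedLabel, Equiv.apply_symm_apply, slide_of_not_le _ _ _ h]
  rfl

theorem label_promoteAt_of_covBy (hP : IsRootedForest P) (π : LinearExt P) {i r s : P}
    (h : i ≤ r) (hrs : r ⋖ s) : (promoteAt π i).label r + 1 = π.label s := by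
  rw [promoteAt, label_promote, promotedLabel, Equiv.apply_symm_apply, slide_eq_of_covBy hP _ h hrs]
  have : π.label i < π.label s := π.label_lt_label (h.trans_lt hrs.lt)
  change lower (π.label i) (π.label s) + 1 = _
  rw [lower, if_pos this]
  omega

theorem label_promoteAt_of_isMax (hP : IsRootedForest P) (π : LinearExt P) {i r : P}
    (h : i ≤ r) (hr : IsMax r) : (promoteAt π i).label r + 1 = Fintype.card P := by
  rw [promoteAt, label_promote, promotedLabel, Equiv.apply_symm_apply, slide_eq_card hP _ h hr]
  have := π.label_lt_card i
  change lower (π.label i) _ + 1 = _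
  rw [lower, if_pos this]
  omega

theorem exists_covBy_or_isMax (r : P) : (∃ s, r ⋖ s) ∨ IsMax r := by
  by_cases h : IsMax r
  · exact Or.inr h
  · obtain ⟨s, hs⟩ := not_isMax_iff.1 h
    obtain ⟨q, hq, -⟩ := exists_covBy_le_of_lt hs
    exact Or.inl ⟨q, hq⟩

theorem label_le_label_promoteAt (hP : IsRootedForest P) (π : LinearExt P) {i r : P}
    (h : i ≤ r) : π.label r ≤ (promoteAt π i).label r := by
  rcases exists_covBy_or_isMax r with ⟨s, hs⟩ | hr
  · have h1 := label_promoteAt_of_covBy hP π h hs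
    have h2 := π.label_lt_label hs.lt
    omega
  · have h1 := label_promoteAt_of_isMax hP π h hr
    have h2 := π.label_lt_card r
    omega

/-- A new label at least `m` comes from an old label at least `m` or from the end of the word. The
seed stands either at the same place in both words or left of `m` in both. -/
theorem agreeFrom_promoteAt (hP : IsRootedForest P) {m : ℕ} {π π' : LinearExt P}
    (h : AgreeFrom m π π') (i : P) : AgreeFrom m (promoteAt π i) (promoteAt π' i) := by
  intro r hr
  have hi := h i
  by_cases hir : i ≤ r
  · rcases exists_covBy_or_isMax r with ⟨s, hs⟩ | hmax
    · have h1 := label_promoteAt_of_covBy hP π hir hs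
      have h2 := label_promoteAt_of_covBy hP π' hir hs
      have h3 := h s
      omega
    · have h1 := label_promoteAt_of_isMax hP π hir hmax
      have h2 := label_promoteAt_of_isMax hP π' hir hmax
      omega
  · rw [label_promoteAt_of_not_le π hir, label_promoteAt_of_not_le π' hir] at *
    have h3 := h r
    unfold lower at *
    split_ifs at * <;> omega

/-- A seed left of `m` shifts the common final stretch one place to the left and fills the last
place in both words with the same element, the maximal one above the seed. -/
theorem agreeFrom_promoteAt_of_lt (hP : IsRootedForest P) {m : ℕ} {π π' : LinearExt P}
    (h : AgreeFrom m π π') {i : P} (hm : π.label i < m) :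
    AgreeFrom (m - 1) (promoteAt π i) (promoteAt π' i) := by
  intro r hr
  have hi := h i
  by_cases hir : i ≤ r
  · rcases exists_covBy_or_isMax r with ⟨s, hs⟩ | hmax
    · have h1 := label_promoteAt_of_covBy hP π hir hs
      have h2 := label_promoteAt_of_covBy hP π' hir hs
      have h3 := h s
      omega
    · have h1 := label_promoteAt_of_isMax hP π hir hmax
      have h2 := label_promoteAt_of_isMax hP π' hir hmax
      omega
  · have h3 := h r
    -- Only the seed itself could stand at position `m - 1` without being lowered.
    have h4 : π.label r ≠ π.label i := fun h4 => hir (π.label_injective h4).ge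
    have h5 : π'.label r ≠ π'.label i := fun h4 => hir (π'.label_injective h4).ge
    rw [label_promoteAt_of_not_le π hir, label_promoteAt_of_not_le π' hir] at *
    unfold lower at *
    split_ifs at * <;> omega

/-- Successive extended promotions along a word of elements. -/
noncomputable def promoteWord (w : List P) (π : LinearExt P) : LinearExt P :=
  w.foldl promoteAt π

theorem agreeFrom_promoteWord (hP : IsRootedForest P) {m : ℕ} (w : List P) {π π' : LinearExt P}
    (h : AgreeFrom m π π') : AgreeFrom m (promoteWord w π) (promoteWord w π') := by
  induction w generalizing π π' with
  | nil => exact h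
  | cons i w ih => exact ih (agreeFrom_promoteAt hP h i)

/-- Applying a word of promotions to two linear extensions that agree from position `m` on either
makes them agree from position `m - 1` on, or concerns only elements from position `m` on. -/
theorem agreeFrom_promoteWord_or (hP : IsRootedForest P) {m : ℕ} (w : List P)
    {π π' : LinearExt P} (h : AgreeFrom m π π') :
    (0 < m ∧ AgreeFrom (m - 1) (promoteWord w π) (promoteWord w π')) ∨
      ∀ i ∈ w, ∀ t, i ≤ t → m ≤ π.label t := by
  induction w generalizing π π' with
  | nil => simp
  | cons i w ih =>
    by_cases hi : π.label i < m
    · exact Or.inl ⟨by omega, agreeFrom_promoteWord hP w (agreeFrom_promoteAt_of_lt hP h hi)⟩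
    · refine (ih (agreeFrom_promoteAt hP h i)).imp id fun h1 => ?_
      -- The induction hypothesis concerns the labels after promotion at `i`. Elements above `i`
      -- stand from `m` on because `i` does; for the others promotion never increases the label.
      intro j hj t hjt
      by_cases hit : i ≤ t
      · exact (not_lt.1 hi).trans (π.label_le_label hit)
      · have h2 : j ∈ w := by
          rcases List.mem_cons.1 hj with rfl | h2
          · exact absurd hjt hit
          · exact h2
        have h3 := h1 j h2 t hjt
        rw [label_promoteAt_of_not_le π hit, lower] at h3
        split_ifs at h3 <;> omega

/-! ### Fixed points of a word and the upper set it generates -/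

variable (T : UpperSetLattice P)

theorem not_le_of_mem_of_notMem {P : Type*} [PartialOrder P] (T : UpperSetLattice P) {i q : P} (hi : i ∈ T.carrier) (hq : q ∉ T.carrier) : ¬ i ≤ q :=
  fun h => hq (T.isUpperSet h hi)

/-- `T` is the upper set generated by the letters of `w`. -/
def IsGeneratedBy (w : List P) : Prop :=
  ∀ t, t ∈ T.carrier ↔ ∃ i ∈ w, i ≤ t

/-- No element outside `T` lies above a seed in `T`, so its label can only be lowered. -/
theorem label_promoteWord_le (w : List P) (hw : ∀ i ∈ w, i ∈ T.carrier)
    (π : LinearExt P) {q : P} (hq : q ∉ T.carrier) :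
    (promoteWord w π).label q ≤ π.label q := by
  induction w generalizing π with
  | nil => exact le_rfl
  | cons i w ih =>
    refine (ih (fun j hj => hw j (List.mem_cons_of_mem _ hj)) (promoteAt π i)).trans ?_
    rw [label_promoteAt_of_not_le π (not_le_of_mem_of_notMem T (hw i List.mem_cons_self) hq), lower]
    split_ifs <;> omega

/-- Labels outside `T` only decrease, so equality at the end forces equality at each step: every
seed, at its turn, stands to the right of the whole complement of `T`. These positions are then
traced back to `π`. -/
theorem label_lt_of_promoteWord_label_eq (w : List P) (hw : ∀ i ∈ w, i ∈ T.carrier)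
    (π : LinearExt P) (h : ∀ q ∉ T.carrier, (promoteWord w π).label q = π.label q) :
    ∀ i ∈ w, ∀ t, i ≤ t → ∀ q ∉ T.carrier, π.label q < π.label t := by
  induction w generalizing π with
  | nil => simp
  | cons i w ih =>
    have hw' : ∀ j ∈ w, j ∈ T.carrier := fun j hj => hw j (List.mem_cons_of_mem _ hj)
    have hiq : ∀ q ∉ T.carrier, ¬ i ≤ q := fun q hq =>
      not_le_of_mem_of_notMem T (hw i List.mem_cons_self) hq
    have h1 : ∀ q ∉ T.carrier, (promoteAt π i).label q = π.label q := by
      intro q hq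
      have h2 := label_promoteWord_le T w hw' (promoteAt π i) hq
      have h3 := h q hq
      have h4 := label_promoteAt_of_not_le π (hiq q hq)
      change (promoteWord w (promoteAt π i)).label q = _ at h3
      unfold lower at h4
      split_ifs at h4 <;> omega
    have h5 : ∀ q ∉ T.carrier, π.label q < π.label i := by
      intro q hq
      have h2 := h1 q hq
      have h3 : π.label q ≠ π.label i := fun h4 => hiq q hq (π.label_injective h4).ge
      rw [label_promoteAt_of_not_le π (hiq q hq), lower] at h2
      split_ifs at h2 <;> omega
    have h6 := ih hw' (promoteAt π i) fun q hq => (h q hq).trans (h1 q hq).symm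
    intro j hj t hjt q hq
    by_cases hit : i ≤ t
    · exact (h5 q hq).trans_le (π.label_le_label hit)
    · have h2 : j ∈ w := by
        rcases List.mem_cons.1 hj with rfl | h2
        · exact absurd hjt hit
        · exact h2
      have h3 := h6 j h2 t hjt q hq
      rw [h1 q hq, label_promoteAt_of_not_le π hit, lower] at h3
      split_ifs at h3 <;> omega

theorem endsWith_of_promoteWord_eq {w : List P} (hw : IsGeneratedBy T w) {π : LinearExt P}
    (h : promoteWord w π = π) : π.EndsWith T := by
  intro t ht q hq
  obtain ⟨i, hi, hit⟩ := (hw t).1 ht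
  exact label_lt_of_promoteWord_label_eq T w (fun i hi => (hw i).2 ⟨i, hi, le_rfl⟩) π
    (fun q _ => by rw [h]) i hi t hit q hq

theorem label_promoteAt_of_endsWith {π : LinearExt P} (hπ : π.EndsWith T) {i q : P}
    (hi : i ∈ T.carrier) (hq : q ∉ T.carrier) : (promoteAt π i).label q = π.label q := by
  have h1 := hπ i hi q hq
  rw [label_promoteAt_of_not_le π (not_le_of_mem_of_notMem T hi hq), lower, if_neg (by omega)]

theorem endsWith_promoteAt (hP : IsRootedForest P) {π : LinearExt P}
    (hπ : π.EndsWith T) {i : P} (hi : i ∈ T.carrier) : (promoteAt π i).EndsWith T := by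
  intro t ht q hq
  rw [label_promoteAt_of_endsWith T hπ hi hq]
  have h1 := hπ i hi q hq
  have h2 := hπ t ht q hq
  by_cases hit : i ≤ t
  · exact h2.trans_le (label_le_label_promoteAt hP π hit)
  · rw [label_promoteAt_of_not_le π hit, lower]
    split_ifs <;> omega

theorem promoteWord_of_endsWith (hP : IsRootedForest P) (w : List P)
    (hw : ∀ i ∈ w, i ∈ T.carrier) {π : LinearExt P} (hπ : π.EndsWith T) :
    (promoteWord w π).EndsWith T ∧ ∀ q ∉ T.carrier, (promoteWord w π).label q = π.label q := by
  induction w generalizing π with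
  | nil => exact ⟨hπ, fun _ _ => rfl⟩
  | cons i w ih =>
    have hi := hw i List.mem_cons_self
    obtain ⟨h1, h2⟩ := ih (fun j hj => hw j (List.mem_cons_of_mem _ hj)) (endsWith_promoteAt T hP hπ hi)
    exact ⟨h1, fun q hq => (h2 q hq).trans (label_promoteAt_of_endsWith T hπ hi hq)⟩

/-- The new label of `t` involves only the labels of `t`, of the seed and of the cover of `t`, all
of them in the upper set `T`. -/
theorem label_promoteWord_congr (hP : IsRootedForest P) (w : List P)
    (hw : ∀ i ∈ w, i ∈ T.carrier) {π π' : LinearExt P}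
    (h : ∀ t ∈ T.carrier, π.label t = π'.label t) :
    ∀ t ∈ T.carrier, (promoteWord w π).label t = (promoteWord w π').label t := by
  induction w generalizing π π' with
  | nil => exact h
  | cons i w ih =>
    refine ih (fun j hj => hw j (List.mem_cons_of_mem _ hj)) fun t ht => ?_
    by_cases hit : i ≤ t
    · rcases exists_covBy_or_isMax t with ⟨s, hs⟩ | hmax
      · have h1 := label_promoteAt_of_covBy hP π hit hs
        have h2 := label_promoteAt_of_covBy hP π' hit hs
        have h3 := h s (T.isUpperSet hs.le ht)
        omega
      · have h1 := label_promoteAt_of_isMax hP π hit hmax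
        have h2 := label_promoteAt_of_isMax hP π' hit hmax
        omega
    · rw [label_promoteAt_of_not_le π hit, label_promoteAt_of_not_le π' hit, h t ht,
        h i (hw i List.mem_cons_self)]

theorem LinearExt.EndsWith.congr {π π' : LinearExt P} (hπ : π.EndsWith T)
    (h : ∀ t ∈ T.carrier, π'.label t = π.label t) : π'.EndsWith T := by
  intro t ht q hq
  by_contra hlt
  -- The element `r` that `π` has in the place of `q` belongs to `T`, so it has the same place in
  -- `π'` and equals `q`.
  obtain ⟨r, hr⟩ := π.exists_label_eq (π'.label_lt_card q)
  have hrT : r ∈ T.carrier := by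
    by_contra hrT
    have h1 := hπ t ht r hrT
    have h2 := h t ht
    omega
  have h3 : r = q := π'.label_injective ((h r hrT).trans hr)
  exact hq (h3 ▸ hrT)

theorem LinearExt.agreeFrom_card (π π' : LinearExt P) :
    AgreeFrom (Fintype.card P) π π' := by
  intro p hp
  have h1 := π.label_lt_card p
  have h2 := π'.label_lt_card p
  omega

/-- For the least `m` from which two fixed points agree, applying `w` cannot improve `m`; hence all
of `T` stands from position `m` on. -/
theorem label_eq_of_promoteWord_eq (hP : IsRootedForest P) {w : List P} (hw : IsGeneratedBy T w)
    {π π' : LinearExt P} (h : promoteWord w π = π) (h' : promoteWord w π' = π') :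
    ∀ t ∈ T.carrier, π.label t = π'.label t := by
  classical
  have hex : ∃ m, AgreeFrom m π π' := ⟨_, LinearExt.agreeFrom_card π π'⟩
  intro t ht
  obtain ⟨i, hi, hit⟩ := (hw t).1 ht
  rcases agreeFrom_promoteWord_or hP w (Nat.find_spec hex) with ⟨h1, h2⟩ | h1
  · rw [h, h'] at h2
    exact absurd h2 (Nat.find_min hex (by omega))
  · exact Nat.find_spec hex t (Or.inl (h1 i hi t hit))

theorem LinearExt.exists_linearExt : Nonempty (LinearExt P) := by
  obtain ⟨π, -⟩ := exists_of_strictMono (P := P) (α := LinearExtension P) toLinearExtension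
    (fun _ _ h => h) (toLinearExtension.monotone.strictMono_of_injective fun _ _ h => h)
  exact ⟨π⟩

theorem LinearExt.exists_endsWith : ∃ π : LinearExt P, π.EndsWith T := by
  classical
  obtain ⟨π⟩ := LinearExt.exists_linearExt (P := P)
  have hlt := fun p => π.label_lt_card p
  obtain ⟨σ, hσ⟩ := exists_of_strictMono
    -- Adding `n` to the labels on `T` moves `T` to the end and keeps the order inside and outside
    -- `T`.
    (fun p => π.label p + if p ∈ T.carrier then Fintype.card P else 0)
    (fun p q h => π.label_injective (by
      have h1 := hlt p
      have h2 := hlt q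
      simp only at h
      split_ifs at h <;> omega))
    (fun p q h => by
      have h1 := π.label_lt_label h
      have h2 : p ∈ T.carrier → q ∈ T.carrier := fun h2 => T.isUpperSet h.le h2
      simp only
      split_ifs with h3 h4 h4
      · omega
      · exact absurd (h2 h3) h4
      · omega
      · omega)
  refine ⟨σ, fun t ht q hq => (hσ q t).2 ?_⟩
  have := hlt q
  simp only [if_pos ht, if_neg hq]
  omega

/-- Among extensions ending with `T`, one agreeing with its image from the least possible `m` is
fixed: otherwise its image, which also ends with `T`, would do better. -/
theorem exists_promoteWord_eq (hP : IsRootedForest P) {w : List P} (hw : IsGeneratedBy T w) :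
    ∃ π, promoteWord w π = π := by
  classical
  have hwT : ∀ i ∈ w, i ∈ T.carrier := fun i hi => (hw i).2 ⟨i, hi, le_rfl⟩
  have hex : ∃ m, ∃ π : LinearExt P, π.EndsWith T ∧ AgreeFrom m π (promoteWord w π) := by
    obtain ⟨π, hπ⟩ := LinearExt.exists_endsWith T
    exact ⟨_, π, hπ, LinearExt.agreeFrom_card _ _⟩
  obtain ⟨π, hπ, h⟩ := Nat.find_spec hex
  obtain ⟨h1, h2⟩ := promoteWord_of_endsWith T hP w hwT hπ
  rcases agreeFrom_promoteWord_or hP w h with ⟨h3, h4⟩ | h3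
  · exact absurd ⟨_, h1, h4⟩ (Nat.find_min hex (by omega))
  · refine ⟨π, ext_label fun t => ?_⟩
    by_cases ht : t ∈ T.carrier
    · obtain ⟨i, hi, hit⟩ := (hw t).1 ht
      exact (h t (Or.inl (h3 i hi t hit))).symm
    · exact h2 t ht

theorem promoteWord_eq_self_iff (hP : IsRootedForest P) {w : List P} (hw : IsGeneratedBy T w)
    {π₀ : LinearExt P} (h₀ : promoteWord w π₀ = π₀) (π : LinearExt P) :
    promoteWord w π = π ↔ ∀ t ∈ T.carrier, π.label t = π₀.label t := by
  have hwT : ∀ i ∈ w, i ∈ T.carrier := fun i hi => (hw i).2 ⟨i, hi, le_rfl⟩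
  refine ⟨fun h => label_eq_of_promoteWord_eq T hP hw h h₀, fun h => ext_label fun t => ?_⟩
  by_cases ht : t ∈ T.carrier
  · rw [label_promoteWord_congr T hP w hwT h t ht, h₀, h t ht]
  · have hπ := (endsWith_of_promoteWord_eq T hw h₀).congr T h
    exact (promoteWord_of_endsWith T hP w hwT hπ).2 t ht

end PromotionWords

/-! ### Covers in the lattice of upper sets -/

theorem UpperSetLattice.exists_insert_of_covBy {P : Type*} [PartialOrder P] [DecidableEq P]
    {T T' : UpperSetLattice P}
    (h : T ⋖ T') : ∃ p ∉ T.carrier, T'.carrier = insert p T.carrier := by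
  have hss : T.carrier ⊂ T'.carrier := h.lt
  -- A maximal element of the difference can be added to `T` without leaving the upper sets.
  obtain ⟨p, hp, hmax⟩ := (T'.carrier \ T.carrier).exists_maximal
    (Finset.sdiff_nonempty.2 hss.2)
  rw [Finset.mem_sdiff] at hp
  refine ⟨p, hp.2, ?_⟩
  have hup : IsUpperSet ((insert p T.carrier : Finset P) : Set P) := by
    intro a b hab ha
    simp only [Finset.coe_insert, Set.mem_insert_iff, Finset.mem_coe] at ha ⊢
    rcases ha with rfl | ha
    · by_cases hb : b ∈ T.carrier
      · exact Or.inr hb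
      · exact Or.inl (le_antisymm (hmax (Finset.mem_sdiff.2 ⟨T'.isUpperSet hab hp.1, hb⟩) hab) hab)
    · exact Or.inr (T.isUpperSet hab ha)
  have h1 : T < ⟨insert p T.carrier, hup⟩ := Finset.ssubset_insert hp.2
  have h2 : (⟨insert p T.carrier, hup⟩ : UpperSetLattice P) ≤ T' :=
    Finset.insert_subset hp.1 hss.1
  by_contra hne
  exact h.2 h1 (lt_of_le_of_ne h2 fun h3 => hne (congrArg carrier h3).symm)

theorem UpperSetLattice.covBy_of_carrier_eq_insert {P : Type*} [PartialOrder P] [DecidableEq P]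
    {T T' : UpperSetLattice P}
    {p : P} (hp : p ∉ T.carrier) (h : T'.carrier = insert p T.carrier) : T ⋖ T' := by
  refine ⟨?_, fun S h1 h2 => ?_⟩
  · change T.carrier ⊂ T'.carrier
    exact h ▸ Finset.ssubset_insert hp
  · change T.carrier ⊂ S.carrier at h1
    change S.carrier ⊂ T'.carrier at h2
    have h3 := Finset.card_lt_card h1
    have h4 := Finset.card_lt_card h2
    rw [h, Finset.card_insert_of_notMem hp] at h4
    omega

/-! ### Counting fixed points by maximal chains -/

section FixedPointCount

variable {P : Type*} [Fintype P] [PartialOrder P]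

open LinearExt

/-- The final segment is extended by the rightmost element outside `T`. -/
theorem LinearExt.exists_covBy_endsWith {π : LinearExt P} {T : UpperSetLattice P}
    (hπ : π.EndsWith T) (hT : T ≠ ⊤) : ∃ T', T ⋖ T' ∧ π.EndsWith T' := by
  classical
  have hne : (Finset.univ \ T.carrier).Nonempty := by
    rw [Finset.sdiff_nonempty]
    exact fun h => hT (top_le_iff.1 h)
  obtain ⟨p, hp, hmax⟩ := Finset.exists_max_image _ π.label hne
  have hpT : p ∉ T.carrier := (Finset.mem_sdiff.1 hp).2
  have hmax' : ∀ q ∉ T.carrier, π.label q ≤ π.label p := fun q hq => hmax q (by simp [hq])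
  let T' : UpperSetLattice P := ⟨insert p T.carrier, by
    intro a b hab ha
    simp only [Finset.coe_insert, Set.mem_insert_iff, Finset.mem_coe] at ha ⊢
    rcases ha with rfl | ha
    · by_contra hb
      rw [not_or] at hb
      have h1 := π.label_lt_label (lt_of_le_of_ne hab (Ne.symm hb.1))
      exact (hmax' b hb.2).not_gt h1
    · exact Or.inr (T.isUpperSet hab ha)⟩
  refine ⟨T', UpperSetLattice.covBy_of_carrier_eq_insert hpT rfl, ?_⟩
  intro t ht q hq
  simp only [T', Finset.mem_insert, not_or] at ht hq
  rcases ht with rfl | ht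
  · exact lt_of_le_of_ne (hmax' q hq.2) fun h => hq.1 (π.label_injective h)
  · exact hπ t ht q hq.2

/-- Two final segments of one word are nested. -/
theorem LinearExt.EndsWith.eq_of_covBy {π : LinearExt P} {T T' T'' : UpperSetLattice P}
    (h' : T ⋖ T') (h'' : T ⋖ T'') (hπ' : π.EndsWith T') (hπ'' : π.EndsWith T'') : T' = T'' := by
  have hle : T' ≤ T'' ∨ T'' ≤ T' := by
    by_contra hc
    rw [not_or] at hc
    obtain ⟨a, ha, ha'⟩ := Finset.not_subset.1 hc.1
    obtain ⟨b, hb, hb'⟩ := Finset.not_subset.1 hc.2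
    exact lt_asymm (hπ' a ha b hb') (hπ'' b hb a ha')
  rcases hle with h | h
  · by_contra hne
    exact h''.2 h'.lt (lt_of_le_of_ne h hne)
  · by_contra hne
    exact h'.2 h''.lt (lt_of_le_of_ne h (Ne.symm hne))

theorem LinearExt.exists_endsWith_of_covBy {π₀ : LinearExt P} {T T' : UpperSetLattice P}
    (hπ₀ : π₀.EndsWith T) (h : T ≤ T') :
    ∃ π : LinearExt P, π.EndsWith T' ∧ ∀ t ∈ T.carrier, π.label t = π₀.label t := by
  classical
  have hTT : ∀ p, p ∈ T.carrier → p ∈ T'.carrier := fun p hp => h hp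
  have hlt := fun p => π₀.label_lt_card p
  obtain ⟨σ, hσ⟩ := exists_of_strictMono
    (fun p => π₀.label p + if p ∈ T'.carrier then Fintype.card P else 0)
    (fun p q h => π₀.label_injective (by
      have h1 := hlt p
      have h2 := hlt q
      simp only at h
      split_ifs at h <;> omega))
    (fun p q h => by
      have h1 := π₀.label_lt_label h
      have h2 : p ∈ T'.carrier → q ∈ T'.carrier := fun h2 => T'.isUpperSet h.le h2
      simp only
      split_ifs with h3 h4 h4
      · omega
      · exact absurd (h2 h3) h4
      · omega
      · omega)
  refine ⟨σ, fun t ht q hq => (hσ q t).2 ?_, fun t ht => ?_⟩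
  · have := hlt q
    simp only [if_pos ht, if_neg hq]
    omega
  · refine label_eq_label_of_forall_lt_iff fun q => ?_
    rw [hσ]
    simp only [if_pos (hTT t ht)]
    have h1 := hlt q
    split_ifs with hq
    · omega
    · have h2 := hπ₀ t ht q fun h3 => hq (hTT q h3)
      omega

theorem LinearExt.EndsWith.label_eq_of_covBy {π π₀ : LinearExt P} {T T' : UpperSetLattice P}
    (h : T ⋖ T') (hπ : π.EndsWith T) (hπ' : π.EndsWith T') (hπ₀ : π₀.EndsWith T)
    (hπ₀' : π₀.EndsWith T') (heq : ∀ t ∈ T.carrier, π.label t = π₀.label t) :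
    ∀ t ∈ T'.carrier, π.label t = π₀.label t := by
  classical
  obtain ⟨p, hp, hT'⟩ := UpperSetLattice.exists_insert_of_covBy h
  intro t ht
  have hcase : t = p ∨ t ∈ T.carrier := by
    rwa [hT', Finset.mem_insert] at ht
  rcases hcase with rfl | htT
  · have key : ∀ σ : LinearExt P, σ.EndsWith T → σ.EndsWith T' →
        ∀ q, σ.label q < σ.label t ↔ q ∉ T'.carrier := by
      intro σ h1 h2 q
      refine ⟨fun hq hqT => ?_, fun hq => h2 t ht q hq⟩
      rw [hT', Finset.mem_insert] at hqT
      rcases hqT with rfl | hqT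
      · exact lt_irrefl _ hq
      · exact lt_asymm hq (h1 q hqT t hp)
    exact label_eq_label_of_forall_lt_iff fun q => by rw [key π hπ hπ', key π₀ hπ₀ hπ₀']
  · exact heq t htT

open Classical in
/-- The linear extensions with a prescribed final segment, whose elements form `T`, correspond to
the maximal chains of upper sets above `T`. -/
theorem card_agree_eq_numMaxChains (T : UpperSetLattice P) (π₀ : LinearExt P)
    (hπ₀ : π₀.EndsWith T) :
    (Finset.univ.filter fun π : LinearExt P => ∀ t ∈ T.carrier, π.label t = π₀.label t).card =
      numMaxChains T := by
  induction T using WellFoundedGT.induction generalizing π₀ with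
  | ind T ih =>
  by_cases hT : T = ⊤
  · subst hT
    rw [numMaxChains_top, Finset.card_eq_one]
    refine ⟨π₀, Finset.ext fun π => ?_⟩
    simp only [Finset.mem_filter, Finset.mem_univ, true_and, Finset.mem_singleton]
    exact ⟨fun h => ext_label fun p => h p (Finset.mem_univ p), fun h => by simp [h]⟩
  · rw [numMaxChains_eq_sum_covBy T hT]
    -- The extensions are sorted by the element just before the segment `T`, that is, by the cover
    -- `T'` they end with.
    have hunion : (Finset.univ.filter fun π : LinearExt P =>
        ∀ t ∈ T.carrier, π.label t = π₀.label t) =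
        (Finset.univ.filter (T ⋖ ·)).biUnion fun T' => Finset.univ.filter fun π : LinearExt P =>
          π.EndsWith T' ∧ ∀ t ∈ T.carrier, π.label t = π₀.label t := by
      ext π
      simp only [Finset.mem_biUnion, Finset.mem_filter, Finset.mem_univ, true_and]
      constructor
      · intro h
        obtain ⟨T', h1, h2⟩ := exists_covBy_endsWith (hπ₀.congr T h) hT
        exact ⟨T', h1, h2, h⟩
      · rintro ⟨-, -, -, h⟩
        exact h
    rw [hunion, Finset.card_biUnion]
    · refine Finset.sum_congr rfl fun T' hT' => ?_
      have hcov : T ⋖ T' := by simpa using hT'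
      obtain ⟨π₁, h1, h2⟩ := exists_endsWith_of_covBy hπ₀ hcov.le
      rw [← ih T' hcov.lt π₁ h1]
      congr 1
      ext π
      simp only [Finset.mem_filter, Finset.mem_univ, true_and]
      constructor
      · rintro ⟨h3, h4⟩
        exact EndsWith.label_eq_of_covBy hcov (hπ₀.congr T h4) h3 (hπ₀.congr T h2) h1
          fun t ht => (h4 t ht).trans (h2 t ht).symm
      · intro h3
        exact ⟨h1.congr T' h3, fun t ht => (h3 t (hcov.le ht)).trans (h2 t ht)⟩
    · intro T' hT' T'' hT'' hne
      have hcov' : T ⋖ T' := by simpa using hT'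
      have hcov'' : T ⋖ T'' := by simpa using hT''
      simp only [Function.onFun]
      rw [Finset.disjoint_left]
      intro π h1 h2
      simp only [Finset.mem_filter, Finset.mem_univ, true_and] at h1 h2
      exact hne (EndsWith.eq_of_covBy hcov' hcov'' h1.1 h2.1)

open Classical in
theorem card_promoteWord_eq_self (hP : IsRootedForest P) (T : UpperSetLattice P) {w : List P}
    (hw : IsGeneratedBy T w) :
    (Finset.univ.filter fun π : LinearExt P => promoteWord w π = π).card = numMaxChains T := by
  obtain ⟨π₀, h₀⟩ := exists_promoteWord_eq T hP hw
  rw [← card_agree_eq_numMaxChains T π₀ (endsWith_of_promoteWord_eq T hw h₀)]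
  simp_rw [promoteWord_eq_self_iff T hP hw h₀]

open Classical in
/-- The upper set generated by the letters of a word. -/
noncomputable def upperSetOfWord (w : List P) : UpperSetLattice P where
  carrier := Finset.univ.filter fun t => ∃ i ∈ w, i ≤ t
  isUpperSet := by
    intro a b hab ha
    simp only [Finset.coe_filter, Finset.mem_univ, true_and, Set.mem_ofPred_eq] at ha ⊢
    obtain ⟨i, hi, hia⟩ := ha
    exact ⟨i, hi, hia.trans hab⟩

theorem isGeneratedBy_upperSetOfWord (w : List P) : IsGeneratedBy (upperSetOfWord w) w := by
  intro t
  simp [upperSetOfWord]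

theorem upperSetOfWord_le_iff (w : List P) (S : UpperSetLattice P) :
    upperSetOfWord w ≤ S ↔ ∀ i ∈ w, i ∈ S.carrier := by
  constructor
  · intro h i hi
    exact h ((isGeneratedBy_upperSetOfWord w i).2 ⟨i, hi, le_rfl⟩)
  · intro h t ht
    obtain ⟨i, hi, hit⟩ := (isGeneratedBy_upperSetOfWord w t).1 ht
    exact S.isUpperSet hit (h i hi)

end FixedPointCount

/-! ### Traces of powers and the characteristic polynomial -/

section Spectrum

/-- The matrix of a map acting on basis vectors, with columns indexed by the source. -/
def functionMatrix {V : Type*} [DecidableEq V] (R : Type*) [CommRing R] (f : V → V) :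
    Matrix V V R :=
  Matrix.of fun a b => if f b = a then 1 else 0

theorem functionMatrix_id {V : Type*} [DecidableEq V] (R : Type*) [CommRing R] :
    functionMatrix R (id : V → V) = 1 := by
  ext a b
  simp [functionMatrix, Matrix.one_apply, eq_comm]

theorem functionMatrix_mul {V : Type*} [Fintype V] [DecidableEq V] (R : Type*) [CommRing R]
    (f g : V → V) : functionMatrix R f * functionMatrix R g = functionMatrix R (f ∘ g) := by
  ext a b
  simp [functionMatrix, Matrix.mul_apply]

theorem trace_functionMatrix {V : Type*} [Fintype V] [DecidableEq V] (R : Type*) [CommRing R]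
    (f : V → V) :
    (functionMatrix R f).trace = ((Finset.univ.filter fun a => f a = a).card : R) := by
  simp [functionMatrix, Matrix.trace]

variable {P : Type*} [Fintype P] [PartialOrder P] {R : Type*} [CommRing R]

/-- The edges leaving `π`, loops included, have total weight `∑ x_i`, so the shift leaves exactly
the weight of the loops on the diagonal. -/
theorem shiftedPromotionMatrix_eq_sum (x : P → R) :
    shiftedPromotionMatrix x = ∑ i, x i • functionMatrix R fun π : LinearExt P => promoteAt π i := by
  classical
  ext π' π
  have hsum : (∑ i, x i • functionMatrix R fun π : LinearExt P => promoteAt π i) π' π =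
      ∑ j with promote π j = π', x (π.word j) := by
    rw [Matrix.sum_apply, Finset.sum_filter, ← π.word.sum_comp]
    simp [functionMatrix, promoteAt]
  rw [hsum, shiftedPromotionMatrix, promotionMatrix, Matrix.add_apply, Matrix.smul_apply,
    Matrix.of_apply, Matrix.one_apply]
  split_ifs with h
  · subst h
    rw [← π'.word.sum_comp, ← Finset.sum_filter_add_sum_filter_not Finset.univ
      (fun j => promote π' j = π')]
    simp
  · simp

theorem shiftedPromotionMatrix_pow (x : P → R) (k : ℕ) :
    shiftedPromotionMatrix x ^ k = ∑ w : Fin k → P,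
      (∏ j, x (w j)) • functionMatrix R (promoteWord (List.ofFn w)) := by
  induction k with
  | zero =>
    have : promoteWord (P := P) [] = id := rfl
    simp [this, functionMatrix_id]
  | succ k ih =>
    -- The rightmost factor acts first, hence it supplies the first letter of the word.
    rw [pow_succ, ih, shiftedPromotionMatrix_eq_sum, ← (Fin.consEquiv fun _ => P).sum_comp,
      Fintype.sum_prod_type, Finset.sum_mul_sum, Finset.sum_comm]
    refine Finset.sum_congr rfl fun i _ => Finset.sum_congr rfl fun w _ => ?_
    rw [smul_mul_smul_comm, functionMatrix_mul]
    have h : promoteWord (List.ofFn (Fin.cons i w : Fin (k + 1) → P)) =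
        promoteWord (List.ofFn w) ∘ fun π => promoteAt π i := by
      funext π
      simp [List.ofFn_succ, promoteWord]
    change _ = (∏ j, x ((Fin.cons i w : Fin (k + 1) → P) j)) •
      functionMatrix R (promoteWord (List.ofFn (Fin.cons i w : Fin (k + 1) → P)))
    rw [h, Fin.prod_univ_succ, mul_comm]
    rfl

/-- Each word contributes `d_S` for every `S` containing all its letters. After exchanging the sums,
the monomials of the words over `S` add up to `x_S ^ k`. -/
theorem trace_shiftedPromotionMatrix_pow (hP : IsRootedForest P) (x : P → R) (k : ℕ) :
    (shiftedPromotionMatrix x ^ k).trace =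
      ∑ S : UpperSetLattice P, (derangementNumber S : R) * (∑ i ∈ S.carrier, x i) ^ k := by
  classical
  have h1 : ∀ w : Fin k → P, (functionMatrix R (promoteWord (List.ofFn w))).trace =
      ∑ S : UpperSetLattice P, if ∀ j, w j ∈ S.carrier then (derangementNumber S : R) else 0 := by
    intro w
    rw [trace_functionMatrix]
    have h2 := card_promoteWord_eq_self hP _ (isGeneratedBy_upperSetOfWord (List.ofFn w))
    have h3 := sum_Ici_derangementNumber (upperSetOfWord (List.ofFn w))
    rw [← h2] at h3
    have h4 : (((Finset.univ.filter fun π : LinearExt P => promoteWord (List.ofFn w) π = π).card : ℤ)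
        : R) = ∑ S ∈ Finset.Icc (upperSetOfWord (List.ofFn w)) ⊤, (derangementNumber S : R) := by
      rw [← h3]
      push_cast
      rfl
    rw [Int.cast_natCast] at h4
    rw [← Finset.sum_filter]
    convert h4 using 2
    ext S
    simp [upperSetOfWord_le_iff]
  rw [shiftedPromotionMatrix_pow, Matrix.trace_sum]
  simp_rw [Matrix.trace_smul, h1, smul_eq_mul, Finset.mul_sum]
  rw [Finset.sum_comm]
  refine Finset.sum_congr rfl fun S _ => ?_
  have h2 : (∑ i ∈ S.carrier, x i) ^ k =
      ∑ w ∈ Fintype.piFinset fun _ : Fin k => S.carrier, ∏ j, x (w j) := by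
    rw [← Finset.prod_univ_sum]
    simp
  rw [h2, Finset.mul_sum, ← Finset.sum_filter_add_sum_filter_not Finset.univ
    (fun w : Fin k → P => ∀ j, w j ∈ S.carrier)]
  rw [Finset.sum_eq_zero (s := Finset.univ.filter fun w : Fin k → P => ¬ ∀ j, w j ∈ S.carrier),
    add_zero]
  · refine Finset.sum_congr ?_ fun w hw => ?_
    · ext w
      simp
    · have hw' : ∀ j, w j ∈ S.carrier := by simpa using hw
      rw [if_pos hw', mul_comm]
  · intro w hw
    have hw' : ¬ ∀ j, w j ∈ S.carrier := by simpa using hw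
    rw [if_neg hw', mul_zero]

theorem map_shiftedPromotionMatrix {R' : Type*} [CommRing R'] (φ : R →+* R') (x : P → R) :
    (shiftedPromotionMatrix x).map φ = shiftedPromotionMatrix fun i => φ (x i) := by
  ext π' π
  simp [shiftedPromotionMatrix_eq_sum, Matrix.sum_apply, functionMatrix, apply_ite φ]

open Polynomial in
-- The generic case lives in `ℤ[x]`, embedded in the algebraic closure of its fraction field; the
-- identity is pulled back to `ℤ[x]` and then specialized to `R`.
theorem derangementNumber_nonneg_and_charpoly (hP : IsRootedForest P) :
    (∀ S : UpperSetLattice P, 0 ≤ derangementNumber S) ∧ ∀ x : P → R,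
      (shiftedPromotionMatrix x).charpoly =
        ∏ S : UpperSetLattice P, (X - C (∑ i ∈ S.carrier, x i)) ^ (derangementNumber S).toNat := by
  classical
  let A := MvPolynomial P ℤ
  let K := AlgebraicClosure (FractionRing A)
  let φ : A →+* K := (algebraMap (FractionRing A) K).comp (algebraMap A (FractionRing A))
  have hφ : Function.Injective φ :=
    (algebraMap (FractionRing A) K).injective.comp (IsFractionRing.injective A (FractionRing A))
  have : CharZero K := by
    have : CharZero (FractionRing A) := charZero_of_injective_algebraMap
      (IsFractionRing.injective A (FractionRing A))
    exact charZero_of_injective_algebraMap (algebraMap (FractionRing A) K).injective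
  have hinj : Function.Injective fun S : UpperSetLattice P =>
      ∑ i ∈ S.carrier, φ (MvPolynomial.X i) := by
    intro S S' h
    simp only [← map_sum] at h
    have h1 := hφ h
    refine UpperSetLattice.ext (Finset.ext fun j => ?_)
    -- Setting `x_j = 1` and the other variables to `0` tests whether `j ∈ S`.
    have h2 := congrArg (MvPolynomial.eval fun i => if i = j then (1 : ℤ) else 0) h1
    simp only [map_sum, MvPolynomial.eval_X, Finset.sum_ite_eq'] at h2
    split_ifs at h2 <;> simp_all
  obtain ⟨hd, hK⟩ := Matrix.count_roots_charpoly_of_trace_pow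
    (shiftedPromotionMatrix fun i => φ (MvPolynomial.X i)) _ hinj _
    (trace_shiftedPromotionMatrix_pow hP _)
  refine ⟨hd, fun x => ?_⟩
  have hA : (shiftedPromotionMatrix (MvPolynomial.X : P → A)).charpoly =
      ∏ S : UpperSetLattice P,
        (X - C (∑ i ∈ S.carrier, MvPolynomial.X i)) ^ (derangementNumber S).toNat := by
    apply Polynomial.map_injective φ hφ
    rw [← Matrix.charpoly_map, map_shiftedPromotionMatrix, hK]
    simp [Polynomial.map_prod, Polynomial.map_sum]
  have h := congrArg (Polynomial.map (MvPolynomial.eval₂Hom (Int.castRingHom R) x)) hA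
  rw [← Matrix.charpoly_map, map_shiftedPromotionMatrix] at h
  simpa [Polynomial.map_prod, Polynomial.map_sum] using h

end Spectrum

theorem mainTheorem1 {P : Type*} [Fintype P] [PartialOrder P] (hP : IsRootedForest P)
    {R : Type*} [CommRing R] (x : P → R) :
    (∀ S : UpperSetLattice P, 0 ≤ derangementNumber S) ∧
    (∀ lam : R,
      (shiftedPromotionMatrix x - lam • (1 : Matrix (LinearExt P) (LinearExt P) R)).det =
        ∏ S : UpperSetLattice P, ((∑ i ∈ S.carrier, x i) - lam) ^ (derangementNumber S).toNat) ∧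
    (∀ [IsDomain R],
      (shiftedPromotionMatrix x).charpoly.roots =
        ∑ S : UpperSetLattice P,
          (derangementNumber S).toNat • ({∑ i ∈ S.carrier, x i} : Multiset R)) := by
  obtain ⟨hd, hx⟩ := derangementNumber_nonneg_and_charpoly (R := R) hP
  refine ⟨hd, fun lam => ?_, ?_⟩
  -- The size of the matrix equals `∑ d_S`, so the sign of `det (-A)` distributes over the factors.
  -- Degrees are compared over `ℤ` because `R` may be trivial.
  · have hcard : Fintype.card (LinearExt P) =
        ∑ S : UpperSetLattice P, (derangementNumber S).toNat := by
      have h := congrArg Polynomial.natDegree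
        ((derangementNumber_nonneg_and_charpoly (R := ℤ) hP).2 fun _ => 0)
      rw [Matrix.charpoly_natDegree_eq_dim, Polynomial.natDegree_prod_of_monic _ _
        fun S _ => (Polynomial.monic_X_sub_C _).pow _] at h
      simpa [Polynomial.natDegree_pow] using h
    have h := congrArg (Polynomial.eval lam) (hx x)
    rw [Matrix.eval_charpoly, Polynomial.eval_prod] at h
    simp only [Polynomial.eval_pow, Polynomial.eval_sub, Polynomial.eval_X, Polynomial.eval_C] at h
    rw [Matrix.smul_one_eq_diagonal, ← neg_sub, Matrix.det_neg, ← Matrix.scalar_apply, h, hcard,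
      ← Finset.prod_pow_eq_pow_sum, ← Finset.prod_mul_distrib]
    refine Finset.prod_congr rfl fun S _ => ?_
    rw [← mul_pow]
    congr 1
    ring
  · intro _
    rw [hx, Polynomial.roots_prod _ _ (Finset.prod_ne_zero_iff.2 fun S _ =>
      pow_ne_zero _ (Polynomial.X_sub_C_ne_zero _))]
    simp only [Polynomial.roots_pow, Polynomial.roots_X_sub_C]
    rfl
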